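/- Let $F \hookrightarrow X \xrightarrow{f} B$ be a surface bundle over a surface, that is, a locally trivial fiber bundle whose fiber $F$ and base $B$ are closed connected orientable surfaces, and assume that $F$ and $B$ both have genus greater than $0$. Let $G=\pi_1(X)$ and $\Gamma=\pi_1(B)$. Assume that $X$ has Albanese dimension $a(X)=2$, meaning that the induced map $f^{*}\colon H^{1}(\Gamma;\mathbb{R})\to H^{1}(G;\mathbb{R})$ is not an isomorphism. Then $G$ algebraically fibers, i.e. there is an epimorphism $G\to\mathbb{Z}$ with finitely generated kernel. -/

import Mathlib

/-- A group algebraically fibers if it has an epimorphism onto `ℤ` with finitely generated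
kernel. -/
def AlgebraicallyFibers (G : Type*) [Group G] : Prop :=
  ∃ φ : G →* Multiplicative ℤ, Function.Surjective φ ∧ φ.ker.FG

/-- The homomorphism `f^* : H^1(Γ; ℝ) → H^1(G; ℝ)` induced by a group homomorphism `f : G → Γ` on
first group cohomology with (trivial) real coefficients. -/
noncomputable def cohomologyOnePullback {G Γ : Type} [Group G] [Group Γ] (f : G →* Γ) :
    groupCohomology (Rep.trivial ℝ Γ ℝ) 1 →ₗ[ℝ] groupCohomology (Rep.trivial ℝ G ℝ) 1 :=
  (groupCohomology.map (A := Rep.trivial ℝ Γ ℝ) (B := Rep.trivial ℝ G ℝ) f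
    (CategoryTheory.CategoryStruct.id (Rep.trivial ℝ G ℝ)) 1).hom

/-- The standard closed orientable surface of genus `g`, as a smooth level set in
`ℂ × ℝ = ℝ³`. Let `P` be the closed disc of radius `4 g + 1` around `0` with the `g` disjoint open
unit discs around `0, 4, …, 4 (g - 1)` removed. The right-hand side of the equation is nonnegative
exactly on `P` and vanishes exactly on the boundary of `P`, to first order. Hence the set is two
copies of `P`, the graphs of the two square roots, glued along the boundary: a sphere for `g = 0`,
a torus for `g = 1`, and in general the double of a disc with `g` holes. -/
def standardSurface (g : ℕ) : Set (ℂ × ℝ) :=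
  {q | q.2 ^ 2 = ((4 * (g : ℝ) + 1) ^ 2 - ‖q.1‖ ^ 2) *
    ∏ i ∈ Finset.range g, (‖q.1 - 4 * (i : ℂ)‖ ^ 2 - 1)}

/-- A closed surface: a compact connected Hausdorff space that is locally homeomorphic to the
Euclidean plane. -/
structure IsClosedSurface (S : Type*) [TopologicalSpace S] : Prop where
  compactSpace : CompactSpace S
  t2Space : T2Space S
  connectedSpace : ConnectedSpace S
  locallyEuclidean : ∀ x : S,
    ∃ e : OpenPartialHomeomorph S (EuclideanSpace ℝ (Fin 2)), x ∈ e.source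

/-- A closed orientable surface of genus `g`. -/
structure IsClosedOrientableSurface (g : ℕ) (S : Type*) [TopologicalSpace S] : Prop
    extends IsClosedSurface S where
  homeomorphic : Nonempty (S ≃ₜ standardSurface g)

/-- The map `f : X → B` is a locally trivial fiber bundle with fiber `F`. -/
def IsLocallyTrivialBundle (F : Type*) {X B : Type*} [TopologicalSpace F] [TopologicalSpace X]
    [TopologicalSpace B] (f : X → B) : Prop :=
  ∀ b : B, ∃ e : Bundle.Trivialization F f, b ∈ e.baseSet

/-- `F → X → B` is a surface bundle over a surface, with fiber of genus `h` and base of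
genus `g`. -/
structure IsSurfaceBundle (h g : ℕ) (F : Type*) {X B : Type*} [TopologicalSpace F]
    [TopologicalSpace X] [TopologicalSpace B] (f : C(X, B)) : Prop where
  fiber : IsClosedOrientableSurface h F
  base : IsClosedOrientableSurface g B
  bundle : IsLocallyTrivialBundle F f

open Classical in
/-- The Albanese dimension of a surface bundle `f : X → B` over a surface: it is one if
`f^* : H^1(π₁ B; ℝ) → H^1(π₁ X; ℝ)` is an isomorphism, and two otherwise. -/
noncomputable def albaneseDimension {X B : Type} [TopologicalSpace X] [TopologicalSpace B]
    (f : C(X, B)) (x₀ : X) : ℕ :=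
  if Function.Bijective (cohomologyOnePullback (FundamentalGroup.map f x₀)) then 1 else 2

/-! Let `K` be the kernel of `G → Γ`. Homotopy lifting over a square shows that `G → Γ` is onto and
that `K` is the image of the fundamental group of the fiber. This image is finitely generated, as a
compact surface has a finite cover by small sets (`FundamentalGroup.fg_of_cover`). Since `H¹(-; ℝ)`
is `Hom(-, ℝ)`, failure of `f^*` to be bijective gives a real character of `G` that is nontrivial on
`K`; its image is free abelian of finite rank, so a coordinate gives an integral character `φ`
nontrivial on `K`. Positive genus of the base gives a nontrivial `α : Γ → ℤ`, by winding around a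
hole.

The core is `AlgebraicallyFibers.of_extension`: the character `χ = φ + n • (α ∘ f)` has finitely
generated kernel for a suitable large `n`. Write `K = ⟨κ, T⟩` with `T` finite in `ker φ` and `φ κ ≠
0`. Then `K ∩ ker φ` is the union of the subgroups `D[a,b]` generated by the `κ ^ i`-conjugates of
`T` with `a ≤ i ≤ b`. Conjugation by some `t ∈ ker φ` with `α (f t) ≠ 0` widens these intervals by
at most a constant `c`, while `κ ^ N` shifts them by `N > c`. With `n` chosen so that `u = t * κ ^
(-N)` lies in `ker χ`, conjugation by `u` and its inverse spreads one finite interval over all of `K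
∩ ker φ = K ∩ ker χ`. Finitely many further elements suffice to generate the image of `ker χ` in
`Γ`, which has finite index. -/

/-! ### Interval subgroups in the kernel of a character -/

/-- The subgroup generated by the conjugates `κ ^ i * l * κ ^ (-i)` with `l ∈ T`, `a ≤ i ≤ b`. -/
def conjInterval {G : Type*} [Group G] (κ : G) (T : Set G) (a b : ℤ) : Subgroup G :=
  Subgroup.closure {x | ∃ i : ℤ, ∃ l ∈ T, a ≤ i ∧ i ≤ b ∧ x = κ ^ i * l * κ ^ (-i)}

section ConjInterval

variable {G : Type*} [Group G] {κ : G} {T : Set G}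

theorem conjInterval_mono {a b a' b' : ℤ} (ha : a' ≤ a) (hb : b ≤ b') :
    conjInterval κ T a b ≤ conjInterval κ T a' b' := by
  apply Subgroup.closure_mono
  rintro x ⟨i, l, hl, h1, h2, rfl⟩
  exact ⟨i, l, hl, ha.trans h1, h2.trans hb, rfl⟩

theorem mem_conjInterval_of_mem {a b i : ℤ} {l : G} (hl : l ∈ T) (h1 : a ≤ i) (h2 : i ≤ b) :
    κ ^ i * l * κ ^ (-i) ∈ conjInterval κ T a b :=
  Subgroup.subset_closure ⟨i, l, hl, h1, h2, rfl⟩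

/-- An interval subgroup is contained in another subgroup after conjugation as soon as its
generators are. -/
theorem conj_mem_of_generators {a b : ℤ} {H : Subgroup G} (t : G)
    (h : ∀ i : ℤ, ∀ l ∈ T, a ≤ i → i ≤ b → t * (κ ^ i * l * κ ^ (-i)) * t⁻¹ ∈ H)
    {x : G} (hx : x ∈ conjInterval κ T a b) : t * x * t⁻¹ ∈ H := by
  have : conjInterval κ T a b ≤ H.comap (MulAut.conj t).toMonoidHom := by
    refine (Subgroup.closure_le _).2 ?_
    rintro x ⟨i, l, hl, h1, h2, rfl⟩
    simpa using h i l hl h1 h2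
  simpa using this hx

theorem zpow_conj_mem_conjInterval {a b : ℤ} (j : ℤ) {x : G} (hx : x ∈ conjInterval κ T a b) :
    κ ^ j * x * κ ^ (-j) ∈ conjInterval κ T (a + j) (b + j) := by
  rw [zpow_neg]
  refine conj_mem_of_generators _ (fun i l hl h1 h2 => ?_) hx
  have := mem_conjInterval_of_mem (κ := κ) (a := a + j) (b := b + j) (i := i + j) hl
    (by omega) (by omega)
  convert this using 1
  rw [add_comm i j, neg_add, zpow_add, add_comm (-j), zpow_add]
  group

theorem exists_mem_conjInterval_of_finite {S : Set G} (hS : S.Finite)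
    (h : ∀ x ∈ S, ∃ c : ℤ, 0 ≤ c ∧ x ∈ conjInterval κ T (-c) c) :
    ∃ c : ℤ, 0 ≤ c ∧ ∀ x ∈ S, x ∈ conjInterval κ T (-c) c := by
  induction S, hS using Set.Finite.induction_on with
  | empty => exact ⟨0, le_rfl, by simp⟩
  | @insert y S _ _ ih =>
    obtain ⟨c, hc0, hc⟩ := ih fun x hx => h x (Set.mem_insert_of_mem _ hx)
    obtain ⟨d, hd0, hd⟩ := h y (Set.mem_insert _ _)
    refine ⟨c + d, by omega, fun x hx => ?_⟩
    rcases hx with rfl | hx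
    · exact conjInterval_mono (by omega) (by omega) hd
    · exact conjInterval_mono (by omega) (by omega) (hc x hx)

/-- Powers of `κ` are collected on the right; moving one past an interval subgroup only shifts the
interval. -/
theorem exists_eq_mul_zpow {x : G} (hx : x ∈ Subgroup.closure (insert κ T)) :
    ∃ d : G, ∃ j c : ℤ, 0 ≤ c ∧ d ∈ conjInterval κ T (-c) c ∧ x = d * κ ^ j := by
  induction hx using Subgroup.closure_induction with
  | mem x hx =>
    rcases hx with rfl | hx
    · exact ⟨1, 1, 0, le_rfl, one_mem _, by simp⟩
    · have h0 := mem_conjInterval_of_mem (κ := κ) (i := 0) hx (le_refl (0 : ℤ)) le_rfl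
      exact ⟨x, 0, 0, le_rfl, by simpa using h0, by simp⟩
  | one => exact ⟨1, 0, 0, le_rfl, one_mem _, by simp⟩
  | mul x y _ _ hx hy =>
    obtain ⟨d, j, c, hc, hd, rfl⟩ := hx
    obtain ⟨e, k, c', hc', he, rfl⟩ := hy
    refine ⟨d * (κ ^ j * e * κ ^ (-j)), j + k, c + c' + |j|, by positivity,
      mul_mem (conjInterval_mono ?_ ?_ hd)
        (conjInterval_mono ?_ ?_ (zpow_conj_mem_conjInterval j he)), ?_⟩
    · have := abs_nonneg j; omega
    · have := abs_nonneg j; omega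
    · have := neg_abs_le j; omega
    · have := le_abs_self j; omega
    · rw [zpow_add]; group
  | inv x _ hx =>
    obtain ⟨d, j, c, hc, hd, rfl⟩ := hx
    refine ⟨κ ^ (-j) * d⁻¹ * κ ^ (-(-j)), -j, c + |j|, by positivity,
      conjInterval_mono ?_ ?_ (zpow_conj_mem_conjInterval (-j) (inv_mem hd)), ?_⟩
    · have := le_abs_self j; omega
    · have := neg_abs_le j; omega
    · group

variable {K : Subgroup G} {φ : G →* Multiplicative ℤ}

theorem map_eq_one_of_mem_conjInterval (hT : ∀ l ∈ T, φ l = 1) {a b : ℤ} {x : G}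
    (hx : x ∈ conjInterval κ T a b) : φ x = 1 := by
  have : conjInterval κ T a b ≤ φ.ker := by
    refine (Subgroup.closure_le _).2 ?_
    rintro x ⟨i, l, hl, h1, h2, rfl⟩
    simp [MonoidHom.mem_ker, hT l hl]
  exact this hx

/-- In the form `d * κ ^ j` the exponent must vanish, because `φ κ` has infinite order. Hence the
interval subgroups exhaust `K ∩ ker φ`. -/
theorem exists_mem_conjInterval (hK : K = Subgroup.closure (insert κ T)) (hκ : φ κ ≠ 1)
    (hT : ∀ l ∈ T, φ l = 1) {x : G} (hx : x ∈ K) (hφ : φ x = 1) :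
    ∃ c : ℤ, 0 ≤ c ∧ x ∈ conjInterval κ T (-c) c := by
  obtain ⟨d, j, c, hc, hd, rfl⟩ := exists_eq_mul_zpow (hK ▸ hx)
  have hj : j = 0 := by
    rw [map_mul, map_eq_one_of_mem_conjInterval hT hd, one_mul, map_zpow] at hφ
    have h2 : j * (φ κ).toAdd = 0 := by simpa using congrArg Multiplicative.toAdd hφ
    have h1 : (φ κ).toAdd ≠ 0 := by simpa using hκ
    exact (mul_eq_zero.1 h2).resolve_right h1
  exact ⟨c, hc, by simpa [hj] using hd⟩

/-- Conjugation by an element of `ker φ` spreads the interval subgroups by a bounded amount. -/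
theorem exists_conj_conjInterval_le [K.Normal] (hK : K = Subgroup.closure (insert κ T))
    (hκ : φ κ ≠ 1) (hT : ∀ l ∈ T, φ l = 1) (hfin : T.Finite) {t : G} (ht : φ t = 1) :
    ∃ c : ℤ, 0 ≤ c ∧ ∀ a b : ℤ, a ≤ 0 → 0 ≤ b → ∀ x ∈ conjInterval κ T a b,
      t * x * t⁻¹ ∈ conjInterval κ T (a - c) (b + c) := by
  have hκK : κ ∈ K := hK ▸ Subgroup.subset_closure (Set.mem_insert _ _)
  have hTK : ∀ l ∈ T, l ∈ K := fun l hl =>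
    hK ▸ Subgroup.subset_closure (Set.mem_insert_of_mem _ hl)
  -- The defect of commutation of `t` and `κ`. It lies in `K ∩ ker φ`, so one constant `c` bounds it
  -- together with the finitely many `t * l * t⁻¹`.
  set y := κ⁻¹ * (t * κ * t⁻¹) with hy
  have hyK : y ∈ K := mul_mem (inv_mem hκK) (Subgroup.Normal.conj_mem ‹_› _ hκK t)
  obtain ⟨c, hc, hcS⟩ := exists_mem_conjInterval_of_finite (κ := κ) (T := T)
    (S := insert y ((fun l => t * l * t⁻¹) '' T)) ((hfin.image _).insert _) (by
      rintro x (rfl | ⟨l, hl, rfl⟩)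
      · exact exists_mem_conjInterval hK hκ hT hyK (by simp [hy, ht])
      · exact exists_mem_conjInterval hK hκ hT (Subgroup.Normal.conj_mem ‹_› _ (hTK l hl) t)
          (by simp [ht, hT l hl]))
  have hyc := hcS y (Set.mem_insert _ _)
  have htκ : t * κ * t⁻¹ = κ * y := by rw [hy]; group
  -- Since `t * κ * t⁻¹ = κ * y`, this element is the product of the shifts of `y` by `1, …, n`, so
  -- the widening does not accumulate with `n`.
  have up : ∀ n : ℕ, t * κ ^ (n : ℤ) * t⁻¹ * κ ^ (-(n : ℤ)) ∈ conjInterval κ T (0 - c) (n + c) := by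
    intro n
    induction n with
    | zero => simp
    | succ n ih =>
      have h1 : t * κ ^ ((n + 1 : ℕ) : ℤ) * t⁻¹ * κ ^ (-((n + 1 : ℕ) : ℤ)) =
          (t * κ ^ (n : ℤ) * t⁻¹ * κ ^ (-(n : ℤ))) *
            (κ ^ (n + 1 : ℤ) * y * κ ^ (-(n + 1 : ℤ))) := by
        push_cast
        rw [zpow_add, hy]
        group
      rw [h1]
      refine mul_mem (conjInterval_mono le_rfl (by push_cast; omega) ih)
        (conjInterval_mono (by omega) (by push_cast; omega)
          (zpow_conj_mem_conjInterval (n + 1 : ℤ) hyc))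
  have down : ∀ n : ℕ, t * κ ^ (-(n : ℤ)) * t⁻¹ * κ ^ (n : ℤ) ∈
      conjInterval κ T (-n - c) (0 + c) := by
    intro n
    induction n with
    | zero => simp
    | succ n ih =>
      have h1 : t * κ ^ (-((n + 1 : ℕ) : ℤ)) * t⁻¹ * κ ^ (((n + 1 : ℕ) : ℤ)) =
          (t * κ ^ (-(n : ℤ)) * t⁻¹ * κ ^ (n : ℤ)) *
            (κ ^ (-n : ℤ) * y⁻¹ * κ ^ (-(-n : ℤ))) := by
        push_cast
        rw [neg_add, zpow_add, zpow_add, hy]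
        group
      rw [h1]
      refine mul_mem (conjInterval_mono (by push_cast; omega) le_rfl ih)
        (conjInterval_mono (by push_cast; omega) (by omega)
          (zpow_conj_mem_conjInterval (-n : ℤ) (inv_mem hyc)))
  refine ⟨c, hc, fun a b ha hb x hx => conj_mem_of_generators t (fun i l hl hai hib => ?_) hx⟩
  have key : t * κ ^ i * t⁻¹ * κ ^ (-i) ∈ conjInterval κ T (a - c) (b + c) := by
    obtain ⟨n, rfl | rfl⟩ := Int.eq_nat_or_neg i
    · exact conjInterval_mono (by omega) (by omega) (up n)
    · rw [neg_neg]
      exact conjInterval_mono (by omega) (by omega) (down n)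
  have hl' := conjInterval_mono (a' := a - c) (b' := b + c) (by omega) (by omega)
    (zpow_conj_mem_conjInterval i (hcS _ (Set.mem_insert_of_mem _ ⟨l, hl, rfl⟩)))
  have h1 : t * (κ ^ i * l * κ ^ (-i)) * t⁻¹ = (t * κ ^ i * t⁻¹ * κ ^ (-i)) *
      (κ ^ i * (t * l * t⁻¹) * κ ^ (-i)) * (t * κ ^ i * t⁻¹ * κ ^ (-i))⁻¹ := by
    group
  rw [h1]
  exact mul_mem (mul_mem key hl') (inv_mem key)

/-- A subgroup which contains a long enough interval subgroup and is stable under conjugation by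
`t * κ ^ (-N)`, with `N` large, contains all interval subgroups. -/
theorem conjInterval_le_of_conj {H : Subgroup G} {t : G} {c N : ℤ} (hc : 0 ≤ c) (hN : c + 1 ≤ N)
    (h1 : ∀ a b : ℤ, a ≤ 0 → 0 ≤ b → ∀ x ∈ conjInterval κ T a b,
      t * x * t⁻¹ ∈ conjInterval κ T (a - c) (b + c))
    (h2 : ∀ a b : ℤ, a ≤ 0 → 0 ≤ b → ∀ x ∈ conjInterval κ T a b,
      t⁻¹ * x * t⁻¹⁻¹ ∈ conjInterval κ T (a - c) (b + c))
    (hu : t * κ ^ (-N) ∈ H) (hH : conjInterval κ T (-c) (c + N) ≤ H) (a b : ℤ) :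
    conjInterval κ T a b ≤ H := by
  have up : ∀ n : ℕ, conjInterval κ T (-c) (c + N + n) ≤ H := by
    intro n
    induction n with
    | zero => simpa using hH
    | succ n ih =>
      refine (Subgroup.closure_le _).2 ?_
      rintro x ⟨i, l, hl, hi1, hi2, rfl⟩
      rcases lt_or_ge i (c + N + n + 1) with hi | hi
      · exact ih (mem_conjInterval_of_mem hl hi1 (by omega))
      -- Only the top index `i = c + N + n + 1` is new. The generator of index `i - N`, conjugated
      -- by `t`, reaches at most `i - N + c < i`, hence lies in `H`; conjugating by the inverse of
      -- `t * κ ^ (-N)` undoes `t` and shifts the index to `i`.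
      have hm := ih (conjInterval_mono (by omega) (by omega)
        (h1 0 (i - N) le_rfl (by omega) _ (mem_conjInterval_of_mem (i := i - N) hl (by omega) le_rfl)))
      have := mul_mem (mul_mem (inv_mem hu) hm) hu
      change _ ∈ H
      convert this using 1
      rw [neg_sub, sub_eq_add_neg, sub_eq_add_neg, zpow_add, zpow_add]
      group
  have down : ∀ n : ℕ, conjInterval κ T (-c - n) (c + N) ≤ H := by
    intro n
    induction n with
    | zero => simpa using hH
    | succ n ih =>
      refine (Subgroup.closure_le _).2 ?_
      rintro x ⟨i, l, hl, hi1, hi2, rfl⟩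
      rcases lt_or_ge (-c - n - 1) i with hi | hi
      · exact ih (mem_conjInterval_of_mem hl (by omega) hi2)
      -- Symmetrically, `t⁻¹`-conjugation followed by the shift by `N` raises the lowest index to at
      -- least `i - c + N > i`.
      have hm := ih (conjInterval_mono (by omega) (by omega) (zpow_conj_mem_conjInterval N
        (h2 i 0 (by omega) le_rfl _ (mem_conjInterval_of_mem (i := i) hl le_rfl (by omega)))))
      have := mul_mem (mul_mem hu hm) (inv_mem hu)
      change _ ∈ H
      convert this using 1
      group
  refine (Subgroup.closure_le _).2 ?_
  rintro x ⟨i, l, hl, -, -, rfl⟩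
  rcases le_or_gt (-c) i with hi | hi
  · exact up i.natAbs (mem_conjInterval_of_mem hl hi (by omega))
  · exact down i.natAbs (mem_conjInterval_of_mem hl (by omega) (by omega))

end ConjInterval

/-! ### Algebraic fibering of group extensions -/

/-- The image of `χ` is infinite cyclic, and corestricting to it does not change the kernel. -/
theorem AlgebraicallyFibers.of_ker_fg {G : Type*} [Group G] (χ : G →* Multiplicative ℤ)
    (hχ : χ ≠ 1) (hfg : χ.ker.FG) : AlgebraicallyFibers G := by
  have : Infinite χ.range := by
    obtain ⟨g, hg⟩ : ∃ g, χ g ≠ 1 := by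
      by_contra! h
      exact hχ (MonoidHom.ext h)
    have hg' : (χ g).toAdd ≠ 0 := by simpa using hg
    refine Infinite.of_injective (fun n : ℤ => (⟨χ (g ^ n), g ^ n, rfl⟩ : χ.range)) ?_
    intro a b hab
    have : χ (g ^ a) = χ (g ^ b) := congrArg Subtype.val hab
    have h2 := congrArg Multiplicative.toAdd this
    simp only [map_zpow, toAdd_zpow, smul_eq_mul] at h2
    exact mul_right_cancel₀ hg' h2
  let e : χ.range ≃* Multiplicative ℤ := mulEquivOfCyclicCardEq
    (by rw [Nat.card_eq_zero_of_infinite, Nat.card_eq_zero_of_infinite])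
  refine ⟨e.toMonoidHom.comp χ.rangeRestrict,
    e.surjective.comp χ.rangeRestrict_surjective, ?_⟩
  have : (e.toMonoidHom.comp χ.rangeRestrict).ker = χ.ker := by
    ext x
    simp [MonoidHom.mem_ker]
  rwa [this]

theorem Group.FG.of_surjective_of_ker_fg {G Γ : Type*} [Group G] [Group Γ] [Group.FG Γ]
    (f : G →* Γ) (hf : Function.Surjective f) (hker : f.ker.FG) : Group.FG G := by
  obtain ⟨S, hS, hSfin⟩ := Group.fg_iff.1 ‹Group.FG Γ›
  choose r hr using hf
  have h1 : (Subgroup.closure (r '' S)).FG := (Subgroup.fg_iff _).2 ⟨_, rfl, hSfin.image r⟩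
  refine Group.fg_def.2 ?_
  convert h1.sup hker
  refine (eq_top_iff.2 fun x _ => ?_).symm
  have : (Subgroup.closure (r '' S)).map f = ⊤ := by
    rw [MonoidHom.map_closure, Set.image_image]
    simpa [hr] using hS
  obtain ⟨y, hy, hyx⟩ : f x ∈ (Subgroup.closure (r '' S)).map f := this ▸ Subgroup.mem_top _
  have h2 : y⁻¹ * x ∈ f.ker := by simp [MonoidHom.mem_ker, hyx]
  simpa using mul_mem (Subgroup.mem_sup_left hy) (Subgroup.mem_sup_right h2)

/-- If a homomorphism to `ℤ` is nontrivial on a finitely generated subgroup `K`, then `K` is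
generated by one element outside the kernel together with finitely many elements of the kernel. -/
theorem exists_generators_of_ne_one {G : Type*} [Group G] {K : Subgroup G} (hK : K.FG)
    (φ : G →* Multiplicative ℤ) {k : G} (hk : k ∈ K) (hφ : φ k ≠ 1) :
    ∃ κ : G, ∃ T : Set G, T.Finite ∧ K = Subgroup.closure (insert κ T) ∧ φ κ ≠ 1 ∧
      ∀ l ∈ T, φ l = 1 := by
  obtain ⟨S, hS, hSfin⟩ := (Subgroup.fg_iff K).1 hK
  obtain ⟨d, hd⟩ := Int.subgroup_cyclic (Subgroup.toAddSubgroup' (K.map φ))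
  have hmem : ∀ z : ℤ, Multiplicative.ofAdd z ∈ K.map φ ↔ ∃ n : ℤ, n * d = z := by
    intro z
    have : z ∈ Subgroup.toAddSubgroup' (K.map φ) ↔ z ∈ AddSubgroup.closure {d} := by rw [hd]
    rw [AddSubgroup.mem_closure_singleton] at this
    simpa using this
  obtain ⟨κ, hκK, hκ⟩ := (hmem d).2 ⟨1, by simp⟩
  have hdiv : ∀ x ∈ K, ∃ n : ℤ, n * d = (φ x).toAdd := fun x hx =>
    (hmem _).1 ⟨x, hx, rfl⟩
  have hSK : ∀ s ∈ S, s ∈ K := fun s hs => hS ▸ Subgroup.subset_closure hs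
  choose! n hn using hdiv
  have hκ1 : φ κ ≠ 1 := by
    intro h
    rw [h] at hκ
    have hd0 : d = 0 := (congrArg Multiplicative.toAdd hκ).symm
    have := hn k hk
    rw [hd0, mul_zero] at this
    exact hφ (by simpa using this.symm)
  -- `κ` maps to a generator of `φ(K)`, so every generator of `K` can be corrected into `ker φ` by a
  -- power of `κ`.
  refine ⟨κ, (fun s => s * κ ^ (-n s)) '' S, hSfin.image _, ?_, hκ1, ?_⟩
  · apply le_antisymm
    · rw [← hS]
      refine (Subgroup.closure_le _).2 fun s hs => ?_
      have h1 : κ ∈ Subgroup.closure (insert κ ((fun s => s * κ ^ (-n s)) '' S)) :=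
        Subgroup.subset_closure (Set.mem_insert _ _)
      have h2 : s * κ ^ (-n s) ∈ Subgroup.closure (insert κ ((fun s => s * κ ^ (-n s)) '' S)) :=
        Subgroup.subset_closure (Set.mem_insert_of_mem _ ⟨s, hs, rfl⟩)
      simpa using mul_mem h2 (zpow_mem h1 (n s))
    · refine (Subgroup.closure_le _).2 ?_
      rintro x (rfl | ⟨s, hs, rfl⟩)
      · exact hκK
      · exact mul_mem (hSK s hs) (zpow_mem hκK _)
  · rintro _ ⟨s, hs, rfl⟩
    apply Multiplicative.toAdd.injective
    have := hn s (hSK s hs)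
    simp [hκ, ← this]

/-- An extension of a finitely generated group `Γ` with nonzero first Betti number by a finitely
generated group `K` algebraically fibers if some homomorphism to `ℤ` is nontrivial on `K`. -/
theorem AlgebraicallyFibers.of_extension {G Γ : Type*} [Group G] [Group Γ] [Group.FG Γ]
    (f : G →* Γ) (hf : Function.Surjective f) (hker : f.ker.FG)
    (φ : G →* Multiplicative ℤ) {k : G} (hk : k ∈ f.ker) (hφ : φ k ≠ 1)
    (α : Γ →* Multiplicative ℤ) (hα : α ≠ 1) : AlgebraicallyFibers G := by
  obtain ⟨κ, T, hTfin, hK, hκ, hT⟩ := exists_generators_of_ne_one hker φ hk hφ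
  have hκK : κ ∈ f.ker := hK ▸ Subgroup.subset_closure (Set.mem_insert _ _)
  have hfκ : f κ = 1 := hκK
  set m : ℤ := (φ κ).toAdd with hm
  have hm0 : m ≠ 0 := by simpa [hm] using hκ
  obtain ⟨γ, hγ⟩ : ∃ γ, α γ ≠ 1 := by
    by_contra! h
    exact hα (MonoidHom.ext h)
  obtain ⟨t₀, rfl⟩ := hf γ
  -- The factor in `K` cancels `φ` and is invisible to `α ∘ f`, so `α (f t)` is `m` times the
  -- nonzero value at `t₀`.
  set t := t₀ ^ m * κ ^ (-(φ t₀).toAdd) with ht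
  have htφ : φ t = 1 := by
    apply Multiplicative.toAdd.injective
    simp [ht, ← hm, mul_comm]
  set e : ℤ := (α (f t)).toAdd with he
  have he0 : e ≠ 0 := by
    have h1 : (α (f t₀)).toAdd ≠ 0 := by simpa using hγ
    simp [he, ht, hfκ, hm0, h1]
  obtain ⟨c₁, hc₁, h₁⟩ := exists_conj_conjInterval_le hK hκ hT hTfin htφ
  obtain ⟨c₂, hc₂, h₂⟩ := exists_conj_conjInterval_le hK hκ hT hTfin (t := t⁻¹) (by simp [htφ])
  set c := c₁ + c₂ with hc
  -- The square makes `N` positive whatever the sign of `e`; the coefficient in `χ` below then gives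
  -- `χ t = m * N = χ (κ ^ N)`.
  set N := (c + 1) * e * e with hNdef
  have hN : c + 1 ≤ N := by
    have : 0 < e * e := mul_self_pos.2 he0
    nlinarith
  set χ : G →* Multiplicative ℤ := φ * (α.comp f) ^ (m * ((c + 1) * e)) with hχ
  have hχx : ∀ x, (χ x).toAdd = (φ x).toAdd + m * ((c + 1) * e) * (α (f x)).toAdd := by
    intro x
    simp [hχ]
  have hχK : ∀ x ∈ f.ker, χ x = φ x := by
    intro x hx
    apply Multiplicative.toAdd.injective
    rw [hχx, MonoidHom.mem_ker.1 hx]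
    simp
  have hu : χ (t * κ ^ (-N)) = 1 := by
    apply Multiplicative.toAdd.injective
    have h1 : (χ t).toAdd = m * N := by
      rw [hχx, htφ, ← he, hNdef]
      simp only [toAdd_one]
      ring
    have h2 : (χ κ).toAdd = m := by rw [hχK κ hκK]
    simp [h1, h2]
    ring
  refine AlgebraicallyFibers.of_ker_fg χ (fun h => hφ (by rw [← hχK k hk, h]; rfl)) ?_
  have hGfg : Group.FG G := Group.FG.of_surjective_of_ker_fg f hf hker
  -- `P` contains every element whose `χ`-value is divisible by `m = χ κ`, so it has finite index in
  -- the finitely generated `G`. Its image in `Γ` is that of `ker χ`.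
  let P : Subgroup G := χ.ker ⊔ f.ker
  have hPfg : (P.map f).FG := by
    have hP : P.FiniteIndex := by
      have : NeZero m.natAbs := ⟨Int.natAbs_ne_zero.2 hm0⟩
      let q : G →* Multiplicative (ZMod m.natAbs) :=
        (AddMonoidHom.toMultiplicative (Int.castAddHom (ZMod m.natAbs))).comp χ
      refine Subgroup.finiteIndex_of_le (H := q.ker) ?_
      intro x hx
      obtain ⟨j, hj⟩ : m ∣ (χ x).toAdd := by
        have h1 : (((χ x).toAdd : ℤ) : ZMod m.natAbs) = 0 :=
          congrArg Multiplicative.toAdd (MonoidHom.mem_ker.1 hx)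
        exact Int.natAbs_dvd.1 ((ZMod.intCast_zmod_eq_zero_iff_dvd _ _).1 h1)
      have h1 : x * κ ^ (-j) ∈ χ.ker := by
        apply Multiplicative.toAdd.injective
        have h2 : (χ κ).toAdd = m := by rw [hχK κ hκK]
        simp [h2, hj, mul_comm]
      simpa using mul_mem (Subgroup.mem_sup_left h1)
        (Subgroup.mem_sup_right (S := χ.ker) (zpow_mem hκK j))
    have hPfg : Group.FG P := inferInstance
    rw [← Group.fg_iff_subgroup_fg]
    exact Group.fg_of_surjective (f.subgroupMap_surjective P)
  have hPmap : P.map f = χ.ker.map f := by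
    rw [Subgroup.map_sup, (Subgroup.map_eq_bot_iff f.ker).2 le_rfl, sup_bot_eq]
  rw [hPmap] at hPfg
  obtain ⟨R, hR, hRfin⟩ := (Subgroup.fg_iff _).1 hPfg
  have hlift : ∀ r ∈ R, ∃ g ∈ χ.ker, f g = r := fun r hr => by
    have : r ∈ χ.ker.map f := hR ▸ Subgroup.subset_closure hr
    exact this
  choose! s hsker hs using hlift
  have hDfg : (conjInterval κ T (-c) (c + N)).FG := by
    refine (Subgroup.fg_iff _).2 ⟨_, rfl, ?_⟩
    refine (((Set.finite_Icc (-c) (c + N)).prod hTfin).image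
      fun p : ℤ × G => κ ^ p.1 * p.2 * κ ^ (-p.1)).subset ?_
    rintro x ⟨i, l, hl, h1, h2, rfl⟩
    exact ⟨(i, l), ⟨⟨h1, h2⟩, hl⟩, rfl⟩
  have hHfg : (Subgroup.closure (insert (t * κ ^ (-N)) (s '' R)) ⊔
      conjInterval κ T (-c) (c + N)).FG :=
    Subgroup.FG.sup ((Subgroup.fg_iff _).2 ⟨_, rfl, (hRfin.image s).insert _⟩) hDfg
  convert hHfg using 1
  set H := Subgroup.closure (insert (t * κ ^ (-N)) (s '' R)) ⊔ conjInterval κ T (-c) (c + N)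
    with hH
  have hTK : ∀ l ∈ T, l ∈ f.ker := fun l hl =>
    hK ▸ Subgroup.subset_closure (Set.mem_insert_of_mem _ hl)
  have hHker : H ≤ χ.ker := by
    refine sup_le ((Subgroup.closure_le _).2 ?_) fun x hx => ?_
    · rintro x (rfl | ⟨r, hr, rfl⟩)
      · exact hu
      · exact hsker r hr
    · have hxK : x ∈ f.ker := by
        have : conjInterval κ T (-c) (c + N) ≤ f.ker := by
          refine (Subgroup.closure_le _).2 ?_
          rintro x ⟨i, l, hl, -, -, rfl⟩
          exact mul_mem (mul_mem (zpow_mem hκK _) (hTK l hl)) (zpow_mem hκK _)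
        exact this hx
      rw [MonoidHom.mem_ker, hχK x hxK, map_eq_one_of_mem_conjInterval hT hx]
  apply le_antisymm
  · intro x hx
    have hall : ∀ a b, conjInterval κ T a b ≤ H := by
      refine conjInterval_le_of_conj (t := t) (N := N) (c := c) (by omega) hN
        (fun a b ha hb x hx => conjInterval_mono (by omega) (by omega) (h₁ a b ha hb x hx))
        (fun a b ha hb x hx => conjInterval_mono (by omega) (by omega) (h₂ a b ha hb x hx))
        (Subgroup.mem_sup_left (Subgroup.subset_closure (Set.mem_insert _ _))) le_sup_right
    have hfx : f x ∈ H.map f := by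
      have h1 : χ.ker.map f ≤ H.map f := by
        rw [← hR]
        refine (Subgroup.closure_le _).2 fun r hr => ⟨s r, ?_, hs r hr⟩
        exact Subgroup.mem_sup_left
          (Subgroup.subset_closure (Set.mem_insert_of_mem _ ⟨r, hr, rfl⟩))
      exact h1 ⟨x, hx, rfl⟩
    obtain ⟨y, hy, hyx⟩ := hfx
    have h1 : y⁻¹ * x ∈ f.ker := by simp [MonoidHom.mem_ker, hyx]
    -- `χ` and `φ` agree on `K`, so the remaining factor lies in `K ∩ ker φ`, which is covered by
    -- intervals.
    have h2 : φ (y⁻¹ * x) = 1 := by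
      rw [← hχK _ h1]
      exact mul_mem (inv_mem (hHker hy)) hx
    obtain ⟨b, -, hb⟩ := exists_mem_conjInterval hK hκ hT h1 h2
    simpa using mul_mem hy (hall _ _ hb)
  · exact hHker

/-- A homomorphism from a finitely generated group to `ℝ` that is nonzero at an element can be
replaced by one to `ℤ`. -/
theorem exists_int_hom_ne_one {G : Type*} [Group G] [Group.FG G] (ψ : Additive G →+ ℝ) {k : G}
    (hk : ψ (Additive.ofMul k) ≠ 0) : ∃ φ : G →* Multiplicative ℤ, φ k ≠ 1 := by
  -- A finitely generated subgroup of `ℝ` is torsion free, hence free; some coordinate of a nonzero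
  -- element is nonzero.
  let A := ψ.range
  have : AddGroup.FG A := inferInstance
  have : Module.Finite ℤ A := Module.Finite.iff_addGroup_fg.2 inferInstance
  let b := Module.Free.chooseBasis ℤ A
  let v : A := ⟨ψ (Additive.ofMul k), Additive.ofMul k, rfl⟩
  have hv : v ≠ 0 := fun h => hk (congrArg Subtype.val h)
  obtain ⟨i, hi⟩ : ∃ i, b.coord i v ≠ 0 := by
    by_contra! h
    exact hv ((b.forall_coord_eq_zero_iff).1 h)
  refine ⟨AddMonoidHom.toMultiplicativeRight
    ((b.coord i).toAddMonoidHom.comp ψ.rangeRestrict), ?_⟩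
  intro h
  exact hi (congrArg Multiplicative.toAdd h)

/-! ### Homotopy lifting for locally trivial maps -/

open scoped unitInterval

section Lifting

variable {F X B : Type*} [TopologicalSpace F] [TopologicalSpace X] [TopologicalSpace B]

/-- A lift along a locally trivial map extends from a closed set `A` to `A ∪ C` if the closed set
`C` lies over a trivialized open set and retracts to `A ∩ C`. -/
theorem Bundle.Trivialization.exists_lift_union {Y : Type*} [TopologicalSpace Y] {f : X → B}
    (e : Bundle.Trivialization F f) {H : Y → B} (hH : Continuous H) {A C : Set Y}
    (hA : IsClosed A) (hC : IsClosed C) (hCe : ∀ y ∈ C, H y ∈ e.baseSet) {r : Y → Y}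
    (hr : ContinuousOn r C) (hrA : Set.MapsTo r C (A ∩ C)) (hrid : ∀ y ∈ A ∩ C, r y = y)
    {s : Y → X} (hs : ContinuousOn s A) (hsH : ∀ y ∈ A, f (s y) = H y) :
    ∃ s' : Y → X, ContinuousOn s' (A ∪ C) ∧ (∀ y ∈ A ∪ C, f (s' y) = H y) ∧ Set.EqOn s' s A := by
  classical
  let g : Y → X := fun y => e.toOpenPartialHomeomorph.symm (H y, (e (s (r y))).2)
  have hgf : ∀ y ∈ C, f (g y) = H y := fun y hy => e.proj_symm_apply' (hCe y hy)
  have hsrc : ∀ y ∈ A ∩ C, s y ∈ e.source := fun y hy => by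
    rw [e.mem_source, hsH y hy.1]
    exact hCe y hy.2
  have hgs : ∀ y ∈ A ∩ C, g y = s y := fun y hy => by
    simp only [g, hrid y hy]
    rw [← hsH y hy.1]
    exact e.symm_apply_mk_proj (hsrc y hy)
  have hg : ContinuousOn g C := by
    refine e.continuousOn_invFun.comp (t := e.target) (hH.continuousOn.prodMk ?_) ?_
    · refine continuous_snd.comp_continuousOn ?_
      refine e.continuousOn_toFun.comp (hs.comp hr fun y hy => (hrA hy).1) ?_
      exact fun y hy => hsrc _ (hrA hy)
    · intro y hy
      rw [e.target_eq]
      exact ⟨hCe y hy, trivial⟩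
  refine ⟨A.piecewise s g, ?_, ?_, fun y hy => Set.piecewise_eq_of_mem _ _ _ hy⟩
  · refine ContinuousOn.union_of_isClosed (hs.congr fun y hy => Set.piecewise_eq_of_mem _ _ _ hy)
      (hg.congr fun y hy => ?_) hA hC
    by_cases h : y ∈ A
    · rw [Set.piecewise_eq_of_mem _ _ _ h, hgs y ⟨h, hy⟩]
    · rw [Set.piecewise_eq_of_notMem _ _ _ h]
  · intro y hy
    by_cases h : y ∈ A
    · rw [Set.piecewise_eq_of_mem _ _ _ h, hsH y h]
    · rw [Set.piecewise_eq_of_notMem _ _ _ h, hgf y (hy.resolve_left h)]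

/-- Over a subdivided unit square, a lift given to the left and below extends cell by cell. -/
theorem exists_lift_of_cells {f : X → B} {H : ℝ × ℝ → B} (hH : Continuous H) {δ : ℝ} (hδ : 0 < δ)
    {n : ℕ} (hn : n * δ = 1)
    (hcell : ∀ i < n, ∀ j < n, ∃ e : Bundle.Trivialization F f,
      ∀ p ∈ Set.Icc (i * δ) ((i + 1) * δ) ×ˢ Set.Icc (j * δ) ((j + 1) * δ), H p ∈ e.baseSet)
    {s : ℝ × ℝ → X} (hs : Continuous s)
    (hsH : ∀ p : ℝ × ℝ, p.1 ≤ 0 ∨ p.2 ≤ 0 → f (s p) = H p) :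
    ∃ s' : ℝ × ℝ → X, ContinuousOn s' {p | p.1 ≤ 1 ∧ p.2 ≤ 1} ∧
      (∀ p : ℝ × ℝ, p.1 ≤ 1 ∧ p.2 ≤ 1 → f (s' p) = H p) ∧
      ∀ p : ℝ × ℝ, p.1 ≤ 1 → p.1 ≤ 0 ∨ p.2 ≤ 0 → s' p = s p := by
  -- The region treated once rows below `j` and the first `i` cells of row `j` are done. The bound
  -- `p.1 ≤ 1` lets a full row `A n j` contain `A 0 (j + 1)`.
  let A : ℕ → ℕ → Set (ℝ × ℝ) := fun i j =>
    {p | p.1 ≤ 1 ∧ (p.1 ≤ 0 ∨ p.2 ≤ j * δ ∨ (p.2 ≤ (j + 1) * δ ∧ p.1 ≤ i * δ))}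
  have hA : ∀ i j, IsClosed (A i j) := fun i j => by
    refine (isClosed_le continuous_fst continuous_const).inter
      ((isClosed_le continuous_fst continuous_const).union
        ((isClosed_le continuous_snd continuous_const).union
          ((isClosed_le continuous_snd continuous_const).inter
            (isClosed_le continuous_fst continuous_const))))
  let P : ℕ → ℕ → Prop := fun i j => ∃ s' : ℝ × ℝ → X, ContinuousOn s' (A i j) ∧
    (∀ p ∈ A i j, f (s' p) = H p) ∧ ∀ p : ℝ × ℝ, p.1 ≤ 1 → p.1 ≤ 0 ∨ p.2 ≤ 0 → s' p = s p
  have mono : ∀ {i j i' j'}, A i' j' ⊆ A i j → P i j → P i' j' := by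
    rintro i j i' j' h ⟨s', h1, h2, h3⟩
    exact ⟨s', h1.mono h, fun p hp => h2 p (h hp), h3⟩
  have h00 : P 0 0 := by
    refine ⟨s, hs.continuousOn, fun p hp => hsH p ?_, fun _ _ _ => rfl⟩
    rcases hp.2 with h | h | h
    · exact Or.inl h
    · exact Or.inr (by simpa using h)
    · exact Or.inl (by simpa using h.2)
  have step : ∀ i < n, ∀ j < n, P i j → P (i + 1) j := by
    rintro i hi j hj ⟨s', h1, h2, h3⟩
    obtain ⟨e, he⟩ := hcell i hi j hj
    set C := Set.Icc (i * δ) ((i + 1) * δ) ×ˢ Set.Icc (j * δ) ((j + 1) * δ) with hC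
    have hi1 : ((i : ℝ) + 1) * δ ≤ 1 := by
      refine le_trans (mul_le_mul_of_nonneg_right ?_ hδ.le) hn.le
      exact_mod_cast hi
    have hi0 : 0 ≤ (i : ℝ) * δ := by positivity
    have hj0 : 0 ≤ (j : ℝ) * δ := by positivity
    have hAC : A (i + 1) j ⊆ A i j ∪ C := by
      rintro ⟨x, y⟩ ⟨hx1, hp⟩
      simp only [A, hC, Set.mem_union, Set.mem_ofPred_eq, Set.mem_prod, Set.mem_Icc] at hp hx1 ⊢
      push_cast at hp
      clear * - hp hx1
      grind
    have hedge : ∀ p ∈ A i j ∩ C, min (p.1 - i * δ) (p.2 - j * δ) = 0 := by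
      rintro ⟨x, y⟩ ⟨⟨-, hp⟩, hpC⟩
      simp only [hC, Set.mem_prod, Set.mem_Icc] at hp hpC ⊢
      clear * - hp hpC hi0
      grind
    obtain ⟨s'', h1', h2', h3'⟩ := e.exists_lift_union hH (hA i j)
      (C := C) (isClosed_Icc.prod isClosed_Icc) he
      -- Slide diagonally until the left or bottom edge of the cell is hit.
      (r := fun p => (p.1 - min (p.1 - i * δ) (p.2 - j * δ),
        p.2 - min (p.1 - i * δ) (p.2 - j * δ))) (by fun_prop)
      (by
        rintro ⟨x, y⟩ hp
        obtain ⟨⟨h1, h2⟩, h3, h4⟩ : (_ ≤ x ∧ x ≤ _) ∧ (_ ≤ y ∧ y ≤ _) := hp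
        dsimp only
        rcases le_total (x - i * δ) (y - j * δ) with h | h
        · rw [min_eq_left h]
          exact ⟨⟨by linarith, Or.inr (Or.inr ⟨by linarith, by linarith⟩)⟩,
            ⟨by linarith, by linarith⟩, by linarith, by linarith⟩
        · rw [min_eq_right h]
          exact ⟨⟨by linarith, Or.inr (Or.inl (by linarith))⟩,
            ⟨by linarith, by linarith⟩, by linarith, by linarith⟩)
      (by
        rintro p hp
        simp [hedge p hp])
      h1 h2
    refine ⟨s'', h1'.mono hAC, fun p hp => h2' p (hAC hp), fun p hp1 hp => ?_⟩
    rw [← h3 p hp1 hp]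
    refine h3' ⟨hp1, ?_⟩
    rcases hp with h | h
    · exact Or.inl h
    · exact Or.inr (Or.inl (h.trans hj0))
  have row : ∀ j ≤ n, P 0 j := by
    intro j
    induction j with
    | zero => exact fun _ => h00
    | succ j ih =>
      intro hj
      have hrow : ∀ i ≤ n, P i j := by
        intro i
        induction i with
        | zero => exact fun _ => ih (by omega)
        | succ i ihi => exact fun h => step i (by omega) j (by omega) (ihi (by omega))
      refine mono ?_ (hrow n le_rfl)
      rintro ⟨x, y⟩ ⟨hx1, hp⟩
      simp only [A, Set.mem_ofPred_eq] at hp hx1 ⊢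
      push_cast at hp
      clear * - hp hx1 hn
      grind
  obtain ⟨s', h1, h2, h3⟩ := row n le_rfl
  have hsub : ∀ p : ℝ × ℝ, p.1 ≤ 1 ∧ p.2 ≤ 1 → p ∈ A 0 n := fun p hp =>
    ⟨hp.1, Or.inr (Or.inl (hn ▸ hp.2))⟩
  exact ⟨s', h1.mono hsub, fun p hp => h2 p (hsub p hp), h3⟩

/-- The homotopy lifting property of a locally trivial bundle for the unit square, relative to the
left and bottom edges. -/
theorem IsLocallyTrivialBundle.exists_lift_square {f : X → B} (hf : IsLocallyTrivialBundle F f)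
    (H : C(I × I, B)) (s : C(I × I, X)) (hs : ∀ p : I × I, p.1 = 0 ∨ p.2 = 0 → f (s p) = H p) :
    ∃ S : C(I × I, X), (∀ p, f (S p) = H p) ∧ ∀ p : I × I, p.1 = 0 ∨ p.2 = 0 → S p = s p := by
  let c : ℝ × ℝ → I × I := fun p =>
    (Set.projIcc 0 1 zero_le_one p.1, Set.projIcc 0 1 zero_le_one p.2)
  have hc : Continuous c := by fun_prop
  have hc0 : ∀ p : ℝ × ℝ, p.1 ≤ 0 ∨ p.2 ≤ 0 → (c p).1 = 0 ∨ (c p).2 = 0 := fun p hp =>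
    hp.imp (fun h => Set.projIcc_of_le_left zero_le_one h)
      (fun h => Set.projIcc_of_le_left zero_le_one h)
  have hcI : ∀ p : I × I, c (p.1, p.2) = p := fun p => by simp [c]
  choose e he using hf
  obtain ⟨δ, hδ, hball⟩ := lebesgue_number_lemma_of_metric
    (s := Set.Icc (0 : ℝ) 1 ×ˢ Set.Icc (0 : ℝ) 1) (isCompact_Icc.prod isCompact_Icc)
    (c := fun b : B => (H ∘ c) ⁻¹' (e b).baseSet)
    (fun b => (e b).open_baseSet.preimage (H.continuous.comp hc))
    (fun p _ => Set.mem_iUnion.2 ⟨H (c p), he _⟩)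
  obtain ⟨n, hn⟩ := exists_nat_one_div_lt hδ
  have hn0 : (0 : ℝ) < n + 1 := by positivity
  obtain ⟨s', h1, h2, h3⟩ := exists_lift_of_cells (F := F) (f := f) (H := H ∘ c)
    (H.continuous.comp hc) (δ := 1 / ((n : ℝ) + 1)) (by positivity) (n := n + 1)
    (by push_cast; field_simp) (by
      intro i hi j hj
      have hle : ∀ k < n + 1, 0 ≤ (k : ℝ) * (1 / (n + 1)) ∧ (k : ℝ) * (1 / (n + 1)) ≤ 1 := by
        intro k hk
        refine ⟨by positivity, ?_⟩
        rw [mul_one_div, div_le_one hn0]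
        exact_mod_cast hk.le
      obtain ⟨b, hb⟩ := hball ((i : ℝ) * (1 / (n + 1)), (j : ℝ) * (1 / (n + 1)))
        ⟨hle i hi, hle j hj⟩
      refine ⟨e b, fun p hp => hb ?_⟩
      obtain ⟨⟨h1, h2⟩, h3, h4⟩ := hp
      rw [add_mul, one_mul] at h2 h4
      rw [Metric.mem_ball, Prod.dist_eq, max_lt_iff, Real.dist_eq, Real.dist_eq, abs_lt, abs_lt]
      constructor <;> constructor <;> linarith)
    (s.continuous.comp hc) (fun p hp => hs _ (hc0 p hp))
  refine ⟨⟨fun p => s' (p.1, p.2), ?_⟩, fun p => ?_, fun p hp => ?_⟩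
  · exact h1.comp_continuous (by fun_prop) fun p => ⟨p.1.2.2, p.2.2.2⟩
  · have := h2 (p.1, p.2) ⟨p.1.2.2, p.2.2.2⟩
    simpa [hcI] using this
  · have := h3 (p.1, p.2) p.1.2.2 (hp.imp (fun h => by simp [h]) (fun h => by simp [h]))
    simpa [hcI] using this

end Lifting

/-! ### Exactness of the homotopy sequence at the fundamental groups -/

section Exactness

variable {F X B : Type*} [TopologicalSpace F] [TopologicalSpace X] [TopologicalSpace B]

/-- The two ways around the boundary of a square are homotopic. -/
theorem Path.Homotopic.of_square (S : C(I × I, X)) {a b c d : X} {left : Path a b}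
    {top : Path b d} {bottom : Path a c} {right : Path c d} (hl : ∀ t, left t = S (0, t))
    (ht : ∀ t, top t = S (t, 1)) (hb : ∀ t, bottom t = S (t, 0))
    (hr : ∀ t, right t = S (1, t)) : (left.trans top).Homotopic (bottom.trans right) := by
  obtain rfl : S (0, 0) = a := by rw [← hl, left.source]
  obtain rfl : S (0, 1) = b := by rw [← hl, left.target]
  obtain rfl : S (1, 0) = c := by rw [← hb, bottom.target]
  obtain rfl : S (1, 1) = d := by rw [← hr, right.target]
  let l : Path ((0 : I), (0 : I)) (0, 1) := ⟨⟨fun t => (0, t), by fun_prop⟩, rfl, rfl⟩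
  let t : Path ((0 : I), (1 : I)) (1, 1) := ⟨⟨fun t => (t, 1), by fun_prop⟩, rfl, rfl⟩
  let b : Path ((0 : I), (0 : I)) (1, 0) := ⟨⟨fun t => (t, 0), by fun_prop⟩, rfl, rfl⟩
  let r : Path ((1 : I), (0 : I)) (1, 1) := ⟨⟨fun t => (1, t), by fun_prop⟩, rfl, rfl⟩
  have hl' : left = l.map S.continuous := Path.ext (funext hl)
  have ht' : top = t.map S.continuous := Path.ext (funext ht)
  have hb' : bottom = b.map S.continuous := Path.ext (funext hb)
  have hr' : right = r.map S.continuous := Path.ext (funext hr)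
  rw [hl', ht', hb', hr', ← Path.map_trans, ← Path.map_trans]
  have : ContractibleSpace I := (convex_Icc (0 : ℝ) 1).contractibleSpace ⟨0, by simp⟩
  exact (SimplyConnectedSpace.paths_homotopic _ _).map S

/-- The inclusion of the fiber of a trivialization over a point of its base set. -/
noncomputable def Bundle.Trivialization.fiberMap {f : X → B} (e : Bundle.Trivialization F f)
    {b : B} (hb : b ∈ e.baseSet) : C(F, X) where
  toFun y := e.toOpenPartialHomeomorph.symm (b, y)
  continuous_toFun := by
    refine e.continuousOn_invFun.comp_continuous (by fun_prop) fun y => ?_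
    rw [e.target_eq]
    exact ⟨hb, trivial⟩

theorem Bundle.Trivialization.proj_fiberMap {f : X → B} (e : Bundle.Trivialization F f)
    {b : B} (hb : b ∈ e.baseSet) (y : F) : f (e.fiberMap hb y) = b :=
  e.proj_symm_apply' hb

theorem Bundle.Trivialization.fiberMap_snd {f : X → B} (e : Bundle.Trivialization F f)
    {b : B} (hb : b ∈ e.baseSet) {x : X} (hx : f x = b) : e.fiberMap hb (e x).2 = x := by
  subst hx
  exact e.symm_apply_mk_proj (e.mem_source.2 hb)

theorem IsLocallyTrivialBundle.surjective_fundamentalGroupMap [PathConnectedSpace F] {f : C(X, B)}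
    (hf : IsLocallyTrivialBundle F f) (x₀ : X) :
    Function.Surjective (FundamentalGroup.map f x₀) := by
  intro g
  obtain ⟨β, rfl⟩ := Path.Homotopic.Quotient.mk_surjective g
  have hmin : ∀ p : I × I, p.1 = 0 ∨ p.2 = 0 → p.1 ⊓ p.2 = 0 := by
    rintro ⟨x, y⟩ (h | h)
    · exact (congrArg (· ⊓ y) h).trans (bot_inf_eq y)
    · exact (congrArg (x ⊓ ·) h).trans (inf_bot_eq x)
  -- The homotopy `β (s ⊓ t)` is constant on the left and bottom edges and restricts to `β` on the
  -- diagonal, so square lifting yields path lifting. The endpoint is then joined to `x₀` inside the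
  -- fiber.
  obtain ⟨S, hS, hS0⟩ := hf.exists_lift_square
    ⟨fun p : I × I => β (p.1 ⊓ p.2), by fun_prop⟩ (.const _ x₀) (fun p hp => by
      change f x₀ = β (p.1 ⊓ p.2)
      rw [hmin p hp, β.source])
  have hSβ : ∀ t : I, f (S (t, t)) = β t := fun t => by simp [hS]
  obtain ⟨e, he⟩ := hf (f x₀)
  have hx1 : f (S (1, 1)) = f x₀ := by rw [hSβ, β.target]
  let d : Path x₀ (S (1, 1)) :=
    ⟨⟨fun t => S (t, t), by fun_prop⟩, hS0 (0, 0) (Or.inl rfl), rfl⟩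
  let δ : Path (S (1, 1)) x₀ :=
    ((PathConnectedSpace.somePath (e (S (1, 1))).2 (e x₀).2).map
      (e.fiberMap he).continuous).cast (e.fiberMap_snd he hx1).symm (e.fiberMap_snd he rfl).symm
  refine ⟨Path.Homotopic.Quotient.mk (d.trans δ), ?_⟩
  have h1 : d.map f.continuous = β.cast rfl hx1 := Path.ext (funext hSβ)
  have h2 : δ.map f.continuous = (Path.refl (f x₀)).cast hx1 rfl :=
    Path.ext (funext fun t => e.proj_fiberMap he _)
  change Path.Homotopic.Quotient.mk ((d.trans δ).map f.continuous) = _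
  rw [Path.map_trans, h1, h2]
  have h3 : (β.cast rfl hx1).trans ((Path.refl (f x₀)).cast hx1 rfl) =
      β.trans (Path.refl _) := by
    ext t
    simp [Path.trans_apply]
  rw [h3]
  exact Path.Homotopic.Quotient.eq.2 (Path.Homotopic.trans_refl β)

theorem IsLocallyTrivialBundle.ker_fundamentalGroupMap_le {f : C(X, B)}
    (hf : IsLocallyTrivialBundle F f) (x₀ : X) {e : Bundle.Trivialization F f}
    (he : f x₀ ∈ e.baseSet) : (FundamentalGroup.map f x₀).ker ≤
      (FundamentalGroup.mapOfEq (e.fiberMap he) (e.fiberMap_snd he rfl)).range := by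
  intro g hg
  obtain ⟨γ, rfl⟩ := Path.Homotopic.Quotient.mk_surjective g
  obtain ⟨h⟩ : (γ.map f.continuous).Homotopic (Path.refl (f x₀)) :=
    Path.Homotopic.Quotient.eq.1 hg
  -- The nullhomotopy is lifted with left edge `γ` and constant bottom edge. The right and top edges
  -- lie in the fiber, and `γ` is homotopic to the loop they form.
  obtain ⟨S, hS, hS0⟩ := hf.exists_lift_square h.toContinuousMap
    (γ.toContinuousMap.comp ⟨Prod.snd, continuous_snd⟩) (by
      rintro ⟨s, t⟩ (h0 | h0)
      · obtain rfl : s = 0 := h0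
        exact (h.apply_zero t).symm
      · obtain rfl : t = 0 := h0
        change f (γ 0) = h (s, 0)
        rw [h.source, γ.source])
  have hS1 : ∀ s : I, f (S (s, 1)) = f x₀ := fun s => (hS _).trans (h.target s)
  have hS2 : ∀ t : I, f (S (1, t)) = f x₀ := fun t => (hS _).trans (h.apply_one t)
  have hγ : ∀ t : I, S (0, t) = γ t := fun t => hS0 (0, t) (Or.inl rfl)
  have hx : ∀ s : I, S (s, 0) = x₀ := fun s => (hS0 (s, 0) (Or.inr rfl)).trans γ.source
  let ρ : Path x₀ (S (1, 1)) :=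
    ⟨⟨fun s => S (s, 1), by fun_prop⟩, by simp [hγ], rfl⟩
  let τ : Path x₀ (S (1, 1)) :=
    ⟨⟨fun s => S (1, s), by fun_prop⟩, hx 1, rfl⟩
  have hsq : (γ.trans ρ).Homotopic ((Path.refl x₀).trans τ) :=
    Path.Homotopic.of_square S (fun t => (hγ t).symm) (fun _ => rfl) (fun t => (hx t).symm)
      (fun _ => rfl)
  let l : Path x₀ x₀ := τ.trans ρ.symm
  have hl : ∀ t, f (l t) = f x₀ := by
    intro t
    simp only [l, Path.trans_apply]
    split_ifs
    · exact hS2 _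
    · exact hS1 _
  have hγl : Path.Homotopic.Quotient.mk γ = Path.Homotopic.Quotient.mk l := by
    have h1 := Path.Homotopic.Quotient.eq.2 hsq
    simp only [Path.Homotopic.Quotient.mk_trans, Path.Homotopic.Quotient.mk_refl,
      Path.Homotopic.Quotient.refl_trans] at h1
    simp only [l, Path.Homotopic.Quotient.mk_trans, Path.Homotopic.Quotient.mk_symm, ← h1]
    simp
  let l' : Path (e x₀).2 (e x₀).2 :=
    ⟨⟨fun t => (e (l t)).2, continuous_snd.comp
      (e.continuousOn_toFun.comp_continuous l.continuous fun t =>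
        e.mem_source.2 ((hl t).symm ▸ he))⟩, by simp, by simp⟩
  refine ⟨Path.Homotopic.Quotient.mk l', ?_⟩
  rw [FundamentalGroup.mapOfEq_apply, hγl, ← Path.Homotopic.Quotient.mk_map,
    ← Path.Homotopic.Quotient.mk_cast]
  congr 1
  ext t
  exact e.fiberMap_snd he (hl t)

theorem IsLocallyTrivialBundle.ker_fundamentalGroupMap_fg {f : C(X, B)}
    (hf : IsLocallyTrivialBundle F f) (hF : ∀ y : F, Group.FG (FundamentalGroup F y)) (x₀ : X) :
    (FundamentalGroup.map f x₀).ker.FG := by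
  obtain ⟨e, he⟩ := hf (f x₀)
  have : (FundamentalGroup.map f x₀).ker =
      (FundamentalGroup.mapOfEq (e.fiberMap he) (e.fiberMap_snd he rfl)).range := by
    refine le_antisymm (hf.ker_fundamentalGroupMap_le x₀ he) ?_
    rintro _ ⟨g, rfl⟩
    obtain ⟨γ, rfl⟩ := Path.Homotopic.Quotient.mk_surjective g
    rw [FundamentalGroup.mapOfEq_apply, MonoidHom.mem_ker]
    change Path.Homotopic.Quotient.mk _ = Path.Homotopic.Quotient.mk (Path.refl (f x₀))
    congr 1
    ext t
    exact e.proj_fiberMap he _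
  rw [this, ← Group.fg_iff_subgroup_fg]
  have := hF (e x₀).2
  infer_instance

end Exactness

/-! ### Finite generation of fundamental groups -/

section FinitelyGenerated

variable {X : Type*} [TopologicalSpace X]

/-- Any two paths in `U` with the same endpoints are homotopic in the ambient space. -/
def HasHomotopicPaths (U : Set X) : Prop :=
  ∀ ⦃x y : X⦄ (p q : Path x y), Set.range p ⊆ U → Set.range q ⊆ U → p.Homotopic q

theorem HasHomotopicPaths.mono {U V : Set X} (hV : HasHomotopicPaths V) (h : U ⊆ V) :
    HasHomotopicPaths U :=
  fun _ _ p q hp hq => hV p q (hp.trans h) (hq.trans h)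

/-- The initial piece of a path, with the starting point of the path. -/
noncomputable def Path.initial {x y : X} (γ : Path x y) (s : I) : Path x (γ s) :=
  (γ.subpath 0 s).cast γ.source.symm rfl

theorem Path.mk_initial_trans {x y : X} (γ : Path x y) (s s' : I) :
    (Path.Homotopic.Quotient.mk (γ.initial s)).trans (.mk (γ.subpath s s')) =
      .mk (γ.initial s') := by
  rw [← Path.Homotopic.Quotient.mk_trans, Path.Homotopic.Quotient.eq]
  have h := Path.Homotopic.pathCast ⟨Path.Homotopy.subpathTransSubpath γ 0 s s'⟩
    γ.source.symm rfl
  exact h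

theorem Path.initial_zero {x y : X} (γ : Path x y) :
    γ.initial 0 = (Path.refl x).cast rfl γ.source := by
  ext t
  simp [Path.initial]

theorem Path.initial_one {x y : X} (γ : Path x y) :
    γ.initial 1 = γ.cast rfl γ.target := by
  ext t
  simp [Path.initial]

/-- The fundamental group is finitely generated if the space has a finite cover by path connected
open sets such that the union of any two that intersect has homotopic paths. -/
theorem FundamentalGroup.fg_of_cover [PathConnectedSpace X] {t : Set X} (ht : t.Finite)
    {W : X → Set X} (hWo : ∀ a ∈ t, IsOpen (W a)) (hWp : ∀ a ∈ t, IsPathConnected (W a))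
    (haW : ∀ a ∈ t, a ∈ W a) (hcov : ∀ x, ∃ a ∈ t, x ∈ W a)
    (hW : ∀ a ∈ t, ∀ b ∈ t, (W a ∩ W b).Nonempty → HasHomotopicPaths (W a ∪ W b)) (x₀ : X) :
    Group.FG (FundamentalGroup X x₀) := by
  -- The tethers `p a` stay in `W a` when possible, which starts the induction `key`.
  have hp : ∀ a : X, ∃ p : Path x₀ a, a ∈ t → x₀ ∈ W a → Set.range p ⊆ W a := by
    intro a
    by_cases h : a ∈ t ∧ x₀ ∈ W a
    · have hj := (hWp a h.1).joinedIn _ h.2 _ (haW a h.1)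
      exact ⟨hj.somePath, fun _ _ => Set.range_subset_iff.2 hj.somePath_mem⟩
    · exact ⟨PathConnectedSpace.somePath _ _, fun h1 h2 => absurd ⟨h1, h2⟩ h⟩
  have hc : ∀ a b : X, ∃ c : Path a b, a ∈ t → b ∈ t → (W a ∩ W b).Nonempty →
      Set.range c ⊆ W a ∪ W b := by
    intro a b
    by_cases h : a ∈ t ∧ b ∈ t ∧ (W a ∩ W b).Nonempty
    · have hj := ((hWp a h.1).union (hWp b h.2.1) h.2.2).joinedIn _ (Or.inl (haW a h.1)) _
        (Or.inr (haW b h.2.1))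
      exact ⟨hj.somePath, fun _ _ _ => Set.range_subset_iff.2 hj.somePath_mem⟩
    · exact ⟨PathConnectedSpace.somePath _ _, fun h1 h2 h3 => absurd ⟨h1, h2, h3⟩ h⟩
  choose p hp using hp
  choose c hc using hc
  let gen : X × X → FundamentalGroup X x₀ := fun ab =>
    Path.Homotopic.Quotient.mk ((p ab.1).trans ((c ab.1 ab.2).trans (p ab.2).symm))
  refine Group.fg_iff.2 ⟨gen '' (t ×ˢ t), ?_, (ht.prod ht).image gen⟩
  set H := Subgroup.closure (gen '' (t ×ˢ t)) with hH
  refine eq_top_iff.2 fun g _ => ?_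
  obtain ⟨γ, rfl⟩ := Path.Homotopic.Quotient.mk_surjective g
  obtain ⟨T, hT0, hTm, ⟨n, hTn⟩, hTs⟩ :=
    exists_monotone_Icc_subset_open_cover_unitInterval
      (fun a : t => (hWo a.1 a.2).preimage γ.continuous) (fun s _ => by
        obtain ⟨a, ha, hs⟩ := hcov (γ s)
        exact Set.mem_iUnion.2 ⟨⟨a, ha⟩, hs⟩)
  let M : Path.Homotopic.Quotient x₀ x₀ → Prop := fun q => (q : FundamentalGroup X x₀) ∈ H
  -- Multiplication in `FundamentalGroup` is concatenation in reverse order.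
  have hmul : ∀ q r, M q → M r → M (q.trans r) := fun q r hq hr => mul_mem hr hq
  -- Close up the initial piece of `γ` through a center `a` and its tether. Passing to the next
  -- center multiplies by one generator, and any connecting path `d` in `W a` may be used.
  have key : ∀ k : ℕ, ∀ s, s = T k → ∀ a ∈ t, ∀ d : Path (γ s) a, Set.range d ⊆ W a →
      M ((Path.Homotopic.Quotient.mk (γ.initial s)).trans
        ((Path.Homotopic.Quotient.mk d).trans (.symm (.mk (p a))))) := by
    intro k
    induction k with
    | zero =>
      intro s hs a ha d hd
      obtain rfl : s = 0 := hs.trans hT0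
      have hx : x₀ ∈ W a := by
        have h := hd ⟨0, d.source⟩
        rwa [show γ 0 = x₀ from γ.source] at h
      have h1 : (Path.Homotopic.Quotient.mk (γ.initial 0)).trans (.mk d) = .mk (p a) := by
        rw [← Path.Homotopic.Quotient.mk_trans, Path.Homotopic.Quotient.eq]
        refine hW a ha a ha ⟨x₀, hx, hx⟩ _ _ ?_ ?_
        · rw [Path.trans_range, γ.initial_zero, Set.union_self]
          refine Set.union_subset ?_ hd
          rintro _ ⟨s, rfl⟩
          exact hx
        · rw [Set.union_self]
          exact hp a ha hx
      rw [← Path.Homotopic.Quotient.trans_assoc, h1, Path.Homotopic.Quotient.trans_symm]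
      exact one_mem H
    | succ k ih =>
      rintro _ rfl a ha d hd
      obtain ⟨⟨b, hb⟩, hsub⟩ := hTs k
      have hle : T k ≤ T (k + 1) := hTm k.le_succ
      have hmem : ∀ s ∈ Set.Icc (T k) (T (k + 1)), γ s ∈ W b := fun s hs => hsub hs
      have hj := (hWp b hb).joinedIn _ (hmem _ ⟨le_rfl, hle⟩) _ (haW b hb)
      have hne : (W b ∩ W a).Nonempty :=
        ⟨γ (T (k + 1)), hmem _ ⟨hle, le_rfl⟩, hd ⟨0, d.source⟩⟩
      have h1 := ih _ rfl b hb hj.somePath (Set.range_subset_iff.2 hj.somePath_mem)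
      have h2 : M ((Path.Homotopic.Quotient.mk (p b)).trans
          ((Path.Homotopic.Quotient.mk (c b a)).trans (.symm (.mk (p a))))) :=
        Subgroup.subset_closure ⟨(b, a), ⟨hb, ha⟩, rfl⟩
      have h3 : (Path.Homotopic.Quotient.mk (γ.subpath (T k) (T (k + 1)))).trans (.mk d) =
          (Path.Homotopic.Quotient.mk hj.somePath).trans (.mk (c b a)) := by
        rw [← Path.Homotopic.Quotient.mk_trans, ← Path.Homotopic.Quotient.mk_trans,
          Path.Homotopic.Quotient.eq]
        refine hW b hb a ha hne _ _ ?_ ?_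
        · rw [Path.trans_range, Path.range_subpath_of_le _ _ _ hle]
          refine Set.union_subset_union ?_ hd
          rintro _ ⟨s, hs, rfl⟩
          exact hmem s hs
        · rw [Path.trans_range]
          exact Set.union_subset
            ((Set.range_subset_iff.2 hj.somePath_mem).trans Set.subset_union_left)
            (hc b a hb ha hne)
      have h4 := hmul _ _ h1 h2
      convert h4 using 1
      rw [← γ.mk_initial_trans (T k) (T (k + 1)), Path.Homotopic.Quotient.trans_assoc,
        ← Path.Homotopic.Quotient.trans_assoc (.mk (γ.subpath _ _)), h3]
      simp only [Path.Homotopic.Quotient.trans_assoc]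
      congr 2
      rw [← Path.Homotopic.Quotient.trans_assoc (.symm _), Path.Homotopic.Quotient.symm_trans,
        Path.Homotopic.Quotient.refl_trans]
  obtain ⟨a, ha, hx⟩ := hcov x₀
  have h1 := key n 1 (hTn n le_rfl).symm a ha ((p a).cast γ.target rfl) (hp a ha hx)
  have h2 : (Path.Homotopic.Quotient.mk (γ.initial 1)).trans (.mk ((p a).cast γ.target rfl)) =
      (Path.Homotopic.Quotient.mk γ).trans (.mk (p a)) := by
    rw [← Path.Homotopic.Quotient.mk_trans, ← Path.Homotopic.Quotient.mk_trans, γ.initial_one]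
    rfl
  rw [← Path.Homotopic.Quotient.trans_assoc, h2, Path.Homotopic.Quotient.trans_assoc,
    Path.Homotopic.Quotient.trans_symm, Path.Homotopic.Quotient.trans_refl] at h1
  exact h1

/-- The fundamental group of a compact, path connected, locally path connected metric space that is
semilocally simply connected is finitely generated. -/
theorem FundamentalGroup.fg_of_compactSpace {X : Type*} [PseudoMetricSpace X] [CompactSpace X]
    [PathConnectedSpace X] [LocallyPathConnectedSpace X]
    (hX : ∀ x : X, ∃ U : Set X, IsOpen U ∧ x ∈ U ∧ HasHomotopicPaths U) (x₀ : X) :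
    Group.FG (FundamentalGroup X x₀) := by
  choose U hUo hxU hU using hX
  obtain ⟨δ, hδ, hball⟩ := lebesgue_number_lemma_of_metric (s := (Set.univ : Set X)) isCompact_univ
    hUo (fun x _ => Set.mem_iUnion.2 ⟨x, hxU x⟩)
  -- With radius `δ / 4`, two sets that meet lie in a ball of radius `δ` about either center.
  let W : X → Set X := fun x => pathComponentIn (Metric.ball x (δ / 4)) x
  have hxW : ∀ x, x ∈ W x := fun x => mem_pathComponentIn_self (Metric.mem_ball_self (by positivity))
  have hWo : ∀ x, IsOpen (W x) := fun x => Metric.isOpen_ball.pathComponentIn x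
  have hWb : ∀ x, W x ⊆ Metric.ball x (δ / 4) := fun x => pathComponentIn_subset
  obtain ⟨t, -, ht⟩ := isCompact_univ.elim_nhds_subcover W fun x _ => (hWo x).mem_nhds (hxW x)
  refine FundamentalGroup.fg_of_cover t.finite_toSet (W := W) (fun a _ => hWo a)
    (fun a _ => isPathConnected_pathComponentIn (Metric.mem_ball_self (by positivity)))
    (fun a _ => hxW a) (fun x => ?_) (fun a _ b _ => ?_) x₀
  · obtain ⟨a, ha, hx⟩ := Set.mem_iUnion₂.1 (ht (Set.mem_univ x))
    exact ⟨a, ha, hx⟩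
  · rintro ⟨z, hza, hzb⟩
    obtain ⟨y, hy⟩ := hball a (Set.mem_univ a)
    refine (hU y).mono (Set.Subset.trans ?_ hy)
    have h1 := Metric.mem_ball.1 (hWb a hza)
    have h2 := Metric.mem_ball'.1 (hWb b hzb)
    rintro x (hx | hx)
    · exact Metric.ball_subset_ball (by linarith) (hWb a hx)
    · have h3 := Metric.mem_ball.1 (hWb b hx)
      have h4 := dist_triangle4 x b z a
      rw [Metric.mem_ball]
      linarith

/-- Convex balls in charts have homotopic paths. -/
theorem OpenPartialHomeomorph.exists_hasHomotopicPaths {E : Type*} [NormedAddCommGroup E]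
    [NormedSpace ℝ E] (e : OpenPartialHomeomorph X E) {x : X} (hx : x ∈ e.source) :
    ∃ U : Set X, IsOpen U ∧ x ∈ U ∧ HasHomotopicPaths U := by
  obtain ⟨r, hr, hball⟩ := Metric.isOpen_iff.1 e.open_target (e x) (e.map_source hx)
  let D := Metric.ball (e x) r
  refine ⟨e.source ∩ e ⁻¹' D, e.isOpen_inter_preimage Metric.isOpen_ball,
    ⟨hx, Metric.mem_ball_self hr⟩, fun y z p q hp hq => ?_⟩
  have : ContractibleSpace D :=
    (convex_ball (e x) r).contractibleSpace ⟨e x, Metric.mem_ball_self hr⟩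
  have hy := hp ⟨0, p.source⟩
  have hz := hp ⟨1, p.target⟩
  let j : C(D, X) := ⟨fun w => e.symm w,
    e.continuousOn_symm.comp_continuous continuous_subtype_val fun w => hball w.2⟩
  let lift : ∀ p : Path y z, Set.range p ⊆ e.source ∩ e ⁻¹' D →
      Path (⟨e y, hy.2⟩ : D) ⟨e z, hz.2⟩ := fun p hp =>
    { toFun := fun s => ⟨e (p s), (hp ⟨s, rfl⟩).2⟩
      continuous_toFun := (e.continuousOn.comp_continuous p.continuous
        fun s => (hp ⟨s, rfl⟩).1).subtype_mk _
      source' := by simp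
      target' := by simp }
  have hlift : ∀ (p : Path y z) (hp : Set.range p ⊆ e.source ∩ e ⁻¹' D),
      p = ((lift p hp).map j.continuous).cast (e.left_inv hy.1).symm (e.left_inv hz.1).symm :=
    fun p hp => Path.ext (funext fun s => (e.left_inv (hp ⟨s, rfl⟩).1).symm)
  rw [hlift p hp, hlift q hq]
  exact ((SimplyConnectedSpace.paths_homotopic _ _).map j).pathCast _ _

end FinitelyGenerated

/-! ### Topology of closed surfaces -/

section Surfaces

variable {S : Type*} [TopologicalSpace S]

theorem IsClosedSurface.locallyPathConnectedSpace (hS : IsClosedSurface S) :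
    LocallyPathConnectedSpace S := by
  choose e he using hS.locallyEuclidean
  let _ : ChartedSpace (EuclideanSpace ℝ (Fin 2)) S :=
    { atlas := Set.range e
      chartAt := e
      mem_chart_source := he
      chart_mem_atlas := fun x => ⟨x, rfl⟩ }
  exact ChartedSpace.locallyPathConnectedSpace (EuclideanSpace ℝ (Fin 2)) S

theorem IsClosedSurface.pathConnectedSpace (hS : IsClosedSurface S) : PathConnectedSpace S := by
  have := hS.locallyPathConnectedSpace
  exact pathConnectedSpace_iff_connectedSpace.2 hS.connectedSpace

theorem IsClosedOrientableSurface.fundamentalGroup_fg {g : ℕ}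
    (hS : IsClosedOrientableSurface g S) (x : S) : Group.FG (FundamentalGroup S x) := by
  obtain ⟨φ⟩ := hS.homeomorphic
  have := φ.isEmbedding.metrizableSpace
  let _ := TopologicalSpace.metrizableSpaceMetric S
  have := hS.compactSpace
  have := hS.toIsClosedSurface.pathConnectedSpace
  have := hS.toIsClosedSurface.locallyPathConnectedSpace
  refine FundamentalGroup.fg_of_compactSpace (fun y => ?_) x
  obtain ⟨e, he⟩ := hS.locallyEuclidean y
  exact e.exists_hasHomotopicPaths he

end Surfaces

/-! ### Winding numbers as characters -/

section Winding

variable {B : Type*} [TopologicalSpace B]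

/-- The change of argument along loops, for a nowhere vanishing complex valued map. -/
theorem exists_hom_of_map_to_punctured_plane (c : C(B, {z : ℂ // z ≠ 0})) (b : B) :
    ∃ ψ : Additive (FundamentalGroup B b) →+ ℝ, ∀ (γ : Path b b) (Γ : I → ℂ), Continuous Γ →
      (∀ t, Complex.exp (Γ t) = c (γ t)) →
        ψ (Additive.ofMul (Path.Homotopic.Quotient.mk γ : FundamentalGroup B b)) =
          (Γ 1 - Γ 0).im := by
  have cov := Complex.isCoveringMap_exp
  set p : ℂ → {z : ℂ // z ≠ 0} := fun z => ⟨_, z.exp_ne_zero⟩ with hp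
  set θ : ℂ := Complex.log (c b) with hθ
  have hθb : p θ = c b := Subtype.ext (Complex.exp_log (c b).2)
  have h0 : ∀ γ : Path b b, (c.comp γ.toContinuousMap) 0 = p θ := fun γ => by
    rw [hθb]
    exact congrArg c γ.source
  let w : Path.Homotopic.Quotient b b → ℝ := fun q => Quotient.lift
    (s := Path.Homotopic.setoid b b)
    (fun γ : Path b b => (cov.liftPath (c.comp γ.toContinuousMap) θ (h0 γ) 1 - θ).im)
    (fun γ γ' h => by
      have := cov.liftPath_apply_one_eq_of_homotopicRel (γ₀ := c.comp γ.toContinuousMap)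
        (γ₁ := c.comp γ'.toContinuousMap) 
        ((show γ.Homotopic γ' from h).elim fun F =>
          ⟨ContinuousMap.HomotopyRel.compContinuousMap F c⟩) θ (h0 γ) (h0 γ')
      simp only [this]) q
  have hw : ∀ (γ : Path b b) (Γ : I → ℂ), Continuous Γ → (∀ t, Complex.exp (Γ t) = c (γ t)) →
      w (Path.Homotopic.Quotient.mk γ) = (Γ 1 - Γ 0).im := by
    intro γ Γ hΓ hlift
    have hexp : Complex.exp (θ - Γ 0) = 1 := by
      rw [Complex.exp_sub, hlift, γ.source, hθ, Complex.exp_log (c b).2, div_self (c b).2]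
    -- Two logarithms along a path differ by a constant, so the increment does not depend on the
    -- choice.
    have h1 : (fun t => Γ t + (θ - Γ 0)) = cov.liftPath (c.comp γ.toContinuousMap) θ (h0 γ) := by
      refine (cov.eq_liftPath_iff (h0 γ)).2 ⟨by fun_prop, ?_, by ring⟩
      ext t
      simp [hp, Complex.exp_add, hexp, hlift]
    have h2 := congrFun h1 1
    change (cov.liftPath (c.comp γ.toContinuousMap) θ (h0 γ) 1 - θ).im = _
    rw [← h2]
    congr 1
    ring
  have hex : ∀ γ : Path b b, ∃ Γ : C(I, ℂ), ∀ t, Complex.exp (Γ t) = c (γ t) := fun γ =>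
    ⟨cov.liftPath (c.comp γ.toContinuousMap) θ (h0 γ), fun t =>
      congrArg Subtype.val (congrFun (cov.liftPath_lifts (c.comp γ.toContinuousMap) θ (h0 γ)) t)⟩
  have hadd : ∀ q r, w (Path.Homotopic.Quotient.trans q r) = w q + w r := by
    intro q r
    obtain ⟨γ, rfl⟩ := Path.Homotopic.Quotient.mk_surjective q
    obtain ⟨γ', rfl⟩ := Path.Homotopic.Quotient.mk_surjective r
    obtain ⟨Γ, hΓ⟩ := hex γ
    obtain ⟨Γ', hΓ'⟩ := hex γ'
    have hexp : Complex.exp (Γ 1 - Γ' 0) = 1 := by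
      rw [Complex.exp_sub, hΓ, hΓ', γ.target, γ'.source, div_self (c b).2]
    let P : Path (Γ 0) (Γ 1) := ⟨Γ, rfl, rfl⟩
    let P' : Path (Γ 1) (Γ' 1 + (Γ 1 - Γ' 0)) :=
      ⟨⟨fun t => Γ' t + (Γ 1 - Γ' 0), by fun_prop⟩, by simp, rfl⟩
    rw [← Path.Homotopic.Quotient.mk_trans, hw _ (P.trans P') (P.trans P').continuous, hw γ Γ
      Γ.continuous hΓ, hw γ' Γ' Γ'.continuous hΓ', (P.trans P').target, (P.trans P').source]
    · simp only [Complex.sub_im, Complex.add_im]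
      ring
    · intro t
      simp only [Path.trans_apply]
      split_ifs
      · exact hΓ _
      · simp [P', Complex.exp_add, hexp, hΓ']
  refine ⟨AddMonoidHom.mk' (fun q => w q.toMul) fun q r => ?_, fun γ Γ hΓ h => hw γ Γ hΓ h⟩
  change w (Path.Homotopic.Quotient.trans r.toMul q.toMul) = _
  rw [hadd, add_comm]

end Winding

/-! ### A nontrivial character for positive genus -/

section StandardSurface

/-- The first hole is centered at `0`: there the factor `i = 0` is `-1` and all others are positive,
so the right-hand side cannot be a square. -/
theorem fst_ne_zero_of_mem_standardSurface {g : ℕ} (hg : 0 < g) {q : ℂ × ℝ}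
    (hq : q ∈ standardSurface g) : q.1 ≠ 0 := by
  intro h0
  have hq' : q.2 ^ 2 = ((4 * (g : ℝ) + 1) ^ 2 - ‖q.1‖ ^ 2) *
    ∏ i ∈ Finset.range g, (‖q.1 - 4 * (i : ℂ)‖ ^ 2 - 1) := hq
  obtain ⟨n, rfl⟩ := Nat.exists_eq_succ_of_ne_zero hg.ne'
  rw [Finset.prod_range_succ', h0] at hq'
  have h1 : 0 < ∏ i ∈ Finset.range n, (‖(0 : ℂ) - 4 * ((i + 1 : ℕ) : ℂ)‖ ^ 2 - 1) := by
    refine Finset.prod_pos fun i _ => ?_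
    have h2 : ‖(0 : ℂ) - 4 * ((i + 1 : ℕ) : ℂ)‖ = 4 * (i + 1) := by
      rw [zero_sub, norm_neg, show 4 * ((i + 1 : ℕ) : ℂ) = ((4 * (i + 1) : ℕ) : ℂ) by push_cast; rfl,
        Complex.norm_natCast]
      push_cast
      rfl
    rw [h2]
    nlinarith [(Nat.cast_nonneg i : (0 : ℝ) ≤ i)]
  have h2 : (0 : ℝ) < (4 * ((n.succ : ℕ) : ℝ) + 1) ^ 2 := by positivity
  simp only [norm_zero, Nat.cast_zero, mul_zero, sub_zero] at hq'
  nlinarith [mul_pos h2 h1, sq_nonneg q.2]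

theorem defining_function_nonneg_of_norm_eq_two {g : ℕ} (hg : 0 < g) {z : ℂ} (hz : ‖z‖ = 2) :
    0 ≤ ((4 * (g : ℝ) + 1) ^ 2 - ‖z‖ ^ 2) *
      ∏ i ∈ Finset.range g, (‖z - 4 * (i : ℂ)‖ ^ 2 - 1) := by
  have hg1 : (1 : ℝ) ≤ g := by exact_mod_cast hg
  refine mul_nonneg (by rw [hz]; nlinarith) (Finset.prod_nonneg fun i _ => ?_)
  have h1 : 2 ≤ ‖z - 4 * (i : ℂ)‖ := by
    rcases Nat.eq_zero_or_pos i with rfl | hi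
    · simp [hz]
    · have hi1 : (1 : ℝ) ≤ i := by exact_mod_cast hi
      have h2 := norm_sub_norm_le (4 * (i : ℂ)) z
      rw [norm_sub_rev, norm_mul, Complex.norm_natCast, hz] at h2
      norm_num at h2
      linarith
  nlinarith

/-- The fundamental group of a surface of positive genus has a nonzero homomorphism to `ℝ`. -/
theorem IsClosedOrientableSurface.exists_hom_ne_zero {B : Type*} [TopologicalSpace B] {g : ℕ}
    (hg : 0 < g) (hB : IsClosedOrientableSurface g B) (b : B) :
    ∃ (ψ : Additive (FundamentalGroup B b) →+ ℝ) (k : FundamentalGroup B b),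
      ψ (Additive.ofMul k) ≠ 0 := by
  obtain ⟨φ⟩ := hB.homeomorphic
  have := hB.toIsClosedSurface.pathConnectedSpace
  let c : C(B, {z : ℂ // z ≠ 0}) :=
    ⟨fun x => ⟨(φ x).1.1, fst_ne_zero_of_mem_standardSurface hg (φ x).2⟩, by fun_prop⟩
  obtain ⟨r, hr⟩ : ∃ r : ℝ, Real.exp r = 2 := ⟨_, Real.exp_log two_pos⟩
  -- The logarithm of the circle of radius `2`, which surrounds the first hole, avoids the others
  -- and lifts to the upper sheet.
  let Γ : I → ℂ := fun t => r + 2 * Real.pi * (t : ℝ) * Complex.I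
  have hΓ : Continuous Γ := by fun_prop
  have hnorm : ∀ t, ‖Complex.exp (Γ t)‖ = 2 := fun t => by
    rw [Complex.norm_exp]
    simp [Γ, hr]
  let τ : I → standardSurface g := fun t =>
    ⟨(Complex.exp (Γ t), √(((4 * (g : ℝ) + 1) ^ 2 - ‖Complex.exp (Γ t)‖ ^ 2) *
      ∏ i ∈ Finset.range g, (‖Complex.exp (Γ t) - 4 * (i : ℂ)‖ ^ 2 - 1))),
      Real.sq_sqrt (defining_function_nonneg_of_norm_eq_two hg (hnorm t))⟩
  have hτ : Continuous τ := by fun_prop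
  have h01 : Complex.exp (Γ 1) = Complex.exp (Γ 0) := by
    simp [Γ, Complex.exp_add, Complex.exp_two_pi_mul_I]
  have hτ01 : τ 1 = τ 0 := Subtype.ext (by simp only [τ, h01])
  let γ : Path (φ.symm (τ 0)) (φ.symm (τ 0)) :=
    ⟨⟨fun t => φ.symm (τ t), by fun_prop⟩, rfl, congrArg φ.symm hτ01⟩
  obtain ⟨ψ, hψ⟩ := exists_hom_of_map_to_punctured_plane c (φ.symm (τ 0))
  have h1 := hψ γ Γ hΓ (fun t => by simp [c, γ, τ])
  let E := FundamentalGroup.fundamentalGroupMulEquivOfPathConnected b (φ.symm (τ 0))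
  refine ⟨ψ.comp (MonoidHom.toAdditive E.toMonoidHom),
    E.symm (Path.Homotopic.Quotient.mk γ : FundamentalGroup B (φ.symm (τ 0))), ?_⟩
  have h2 : ψ (Additive.ofMul (Path.Homotopic.Quotient.mk γ : FundamentalGroup B _)) ≠ 0 := by
    rw [h1]
    simp [Γ, Real.pi_ne_zero]
  exact fun h3 => h2
    ((congrArg (fun k => ψ (Additive.ofMul k)) (E.apply_symm_apply _)).symm.trans h3)

end StandardSurface

/-! ### First cohomology as characters -/

section Cohomology

variable {G Γ : Type} [Group G] [Group Γ]

theorem H1IsoOfIsTrivial_cohomologyOnePullback (f : G →* Γ)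
    (x : groupCohomology (Rep.trivial ℝ Γ ℝ) 1) (g : G) :
    (groupCohomology.H1IsoOfIsTrivial (Rep.trivial ℝ G ℝ)).hom (cohomologyOnePullback f x)
      (Additive.ofMul g) =
    (groupCohomology.H1IsoOfIsTrivial (Rep.trivial ℝ Γ ℝ)).hom x (Additive.ofMul (f g)) := by
  induction x using groupCohomology.H1_induction_on with
  | h a =>
    let a' : groupCohomology.cocycles₁ (Rep.trivial ℝ G ℝ) :=
      groupCohomology.mapCocycles₁ (A := Rep.trivial ℝ Γ ℝ) (B := Rep.trivial ℝ G ℝ) f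
        (CategoryTheory.CategoryStruct.id (Rep.trivial ℝ G ℝ)) a
    have h1 : cohomologyOnePullback f (groupCohomology.H1π _ a) =
        groupCohomology.H1π (Rep.trivial ℝ G ℝ) a' :=
      groupCohomology.H1π_comp_map_apply (A := Rep.trivial ℝ Γ ℝ) (B := Rep.trivial ℝ G ℝ) f
        (CategoryTheory.CategoryStruct.id (Rep.trivial ℝ G ℝ)) a
    rw [h1, groupCohomology.H1IsoOfIsTrivial_H1π_apply_apply,
      groupCohomology.H1IsoOfIsTrivial_H1π_apply_apply]
    rfl

/-- If an epimorphism does not induce an isomorphism on first real cohomology, then some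
homomorphism to `ℝ` is nontrivial on its kernel. -/
theorem exists_hom_ne_zero_on_ker {f : G →* Γ} (hf : Function.Surjective f)
    (hnot : ¬ Function.Bijective (cohomologyOnePullback f)) :
    ∃ (ψ : Additive G →+ ℝ) (k : G), k ∈ f.ker ∧ ψ (Additive.ofMul k) ≠ 0 := by
  by_contra! h
  let eG := (groupCohomology.H1IsoOfIsTrivial (Rep.trivial ℝ G ℝ)).toLinearEquiv
  let eΓ := (groupCohomology.H1IsoOfIsTrivial (Rep.trivial ℝ Γ ℝ)).toLinearEquiv
  have nat : ∀ x g, eG (cohomologyOnePullback f x) (Additive.ofMul g) =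
      eΓ x (Additive.ofMul (f g)) := H1IsoOfIsTrivial_cohomologyOnePullback f
  refine hnot ⟨fun x y hxy => eΓ.injective ?_, fun y => ?_⟩
  · refine AddMonoidHom.ext fun γ => ?_
    obtain ⟨g, hg⟩ := hf γ.toMul
    have h1 := nat x g
    rw [hxy, nat y g, hg] at h1
    exact h1.symm
  · let ψ : Additive G →+ ℝ := eG y
    -- A character that kills `ker f` descends along the surjection `f`, giving surjectivity of
    -- `f^*`.
    obtain ⟨ψ', hψ'⟩ : ∃ ψ' : Additive Γ →+ ℝ, ∀ g,
        ψ' (Additive.ofMul (f g)) = ψ (Additive.ofMul g) := by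
      let q : G →* Multiplicative ℝ := AddMonoidHom.toMultiplicativeRight ψ
      have hq : f.ker ≤ q.ker := fun k hk => congrArg Multiplicative.ofAdd (h ψ k hk)
      refine ⟨MonoidHom.toAdditiveLeft (f.liftOfSurjective hf ⟨q, hq⟩), fun g => ?_⟩
      exact congrArg Multiplicative.toAdd
        (MonoidHom.liftOfRightInverse_comp_apply f _ _ ⟨q, hq⟩ g)
    refine ⟨eΓ.symm ψ', eG.injective (AddMonoidHom.ext fun g => ?_)⟩
    have h1 := nat (eΓ.symm ψ') g.toMul
    rw [eΓ.apply_symm_apply] at h1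
    exact h1.trans (hψ' g.toMul)

end Cohomology

theorem theorem2 {F X B : Type} [TopologicalSpace F] [TopologicalSpace X] [TopologicalSpace B]
    (h g : ℕ) (hh : 0 < h) (hg : 0 < g) (f : C(X, B)) (hf : IsSurfaceBundle h g F f)
    (x₀ : X) (ha : albaneseDimension f x₀ = 2) :
    AlgebraicallyFibers (FundamentalGroup X x₀) := by
  have := hf.fiber.toIsClosedSurface.pathConnectedSpace
  have := hf.base.fundamentalGroup_fg (f x₀)
  have hsurj := hf.bundle.surjective_fundamentalGroupMap x₀
  have hker := hf.bundle.ker_fundamentalGroupMap_fg hf.fiber.fundamentalGroup_fg x₀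
  have := Group.FG.of_surjective_of_ker_fg _ hsurj hker
  have hnot : ¬ Function.Bijective (cohomologyOnePullback (FundamentalGroup.map f x₀)) := by
    intro hbij
    simp [albaneseDimension, hbij] at ha
  obtain ⟨ψ, k, hk, hψ⟩ := exists_hom_ne_zero_on_ker hsurj hnot
  obtain ⟨φ, hφ⟩ := exists_int_hom_ne_one ψ hψ
  obtain ⟨ω, l, hω⟩ := hf.base.exists_hom_ne_zero hg (f x₀)
  obtain ⟨α, hα⟩ := exists_int_hom_ne_one ω hω
  exact .of_extension _ hsurj hker φ hk hφ α fun h1 => hα (by rw [h1]; rfl)
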